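/- Let $n,l\ge 0$ be integers and let $k_1,\dots,k_l\ge 0$ be integers with $k_1+\dots+k_l=n$. For $A_1,\dots,A_l\in M_n(\mathbb C)$ let $A$ be the operator on $\bigotimes_{i=1}^l \bigwedge^{k_i}\mathbb C^n$ that is the sum over $i$ of the derivation of $\bigwedge^{k_i}\mathbb C^n$ induced by $A_i$ acting on the $i$-th factor, i.e. $$A\Big(\bigotimes_{i}v_{i,1}\wedge\dots\wedge v_{i,k_i}\Big)=\sum_{i=1}^l\sum_{j=1}^{k_i}\Big(\bigotimes_{p<i}\bigwedge_q v_{p,q}\Big)\otimes\big(v_{i,1}\wedge\dots\wedge A_iv_{i,j}\wedge\dots\wedge v_{i,k_i}\big)\otimes\Big(\bigotimes_{p>i}\bigwedge_q v_{p,q}\Big).$$ Let $\bar w$ be the linear functional with $\bar w\big(\bigotimes_i v_{i,1}\wedge\dots\wedge v_{i,k_i}\big)=\det(v_{1,1},\dots,v_{l,k_l})$, let $N=\prod_i\binom n{k_i}$, let $M(A_1,\dots,A_l)$ be the $N\times N$ matrix with rows $\bar w,\bar wA,\dots,\bar wA^{N-1}$ (in coordinates with respect to the standard basis of $\bigotimes_i\bigwedge^{k_i}\mathbb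 C^n$, enumerated in some fixed order), and let $P=\det M$, a polynomial in the entries of the $A_i$ (changing the order of the basis changes $P$ at most by a sign). Let $k'=(k'_1,\dots,k'_l)$ be integers with $0\le k'_i\le k_i$ and $\sum_i k'_i>1$. Then there is a (necessarily unique) complex polynomial $d_{k'}$ in the entries of $A_1,\dots,A_l$ such that, whenever $\lambda_{i,1},\dots,\lambda_{i,n}$ are the eigenvalues of $A_i$ with multiplicity, $$d_{k'}(A_1,\dots,A_l)=\prod_{F,G}\ \sum_{i=1}^l\Big(\sum_{j\in F(i)}\lambda_{i,j}-\sum_{j\in G(i)}\lambda_{i,j}\Big),$$ where $(F,G)$ runs through all ordered pairs of maps from $\{1,\dots,l\}$ to subsets of $\{1,\dots,n\}$ with $|F(i)|=|G(i)|=k'_i$ and $F(i)\cap G(i)=\emptyset$ for all $i$. Moreover $d_{k'}$ is the square of a polynomial, and if $D_{k'}$ is a polynomial with $D_{k'}^2=d_{k'}$ (it is unique up to sign), then $P$ is divisible, in the ring of complex polynomials in the entries of $A_1,\dots,A_l$, by $$D_{k'}^{\,\prod_{i=1}^l\binom{n-2k'_i}{k_i-k'_i}}.$$ (If $2k'_i>n$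 for some $i$, then the product defining $d_{k'}$ is empty, $D_{k'}=\pm1$, and the value given to the binomial coefficient is immaterial.) -/

import Mathlib

open scoped TensorProduct

noncomputable section

namespace KrylovTuple

section Operators

variable {R : Type*} [CommRing R] {n l : ℕ}

/-- The endomorphism of the `k`-th exterior power of `M` induced by `f : M → M` as a derivation:
`v₁ ∧ ⋯ ∧ v_k ↦ ∑ j, v₁ ∧ ⋯ ∧ f v_j ∧ ⋯ ∧ v_k` (see `wedgeDerivation_ιMulti`). -/
def wedgeDerivation {M : Type*} [AddCommGroup M] [Module R M] (k : ℕ) (f : M →ₗ[R] M) :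
    (⋀[R]^k M) →ₗ[R] (⋀[R]^k M) :=
  exteriorPower.alternatingMapLinearEquiv
    { (∑ j : Fin k, (exteriorPower.ιMulti R k (M := M)).toMultilinearMap.compLinearMap
        (Function.update (fun _ => LinearMap.id) j f)) with
      map_eq_zero_of_eq' := by
        intro v a b hab hne
        have key : ∀ j : Fin k, (fun i => (Function.update
            (fun _ : Fin k => (LinearMap.id : M →ₗ[R] M)) j f) i (v i))
              = Function.update v j (f (v j)) := by
          intro j
          funext i
          by_cases h : i = j
          · subst h; simp
          · simp [h]
        simp only [MultilinearMap.toFun_eq_coe, sum_apply,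
          MultilinearMap.compLinearMap_apply, key, AlternatingMap.coe_multilinearMap]
        rw [Finset.sum_eq_add a b hne]
        · have hswap : Function.update v b (f (v b))
              = (Function.update v a (f (v a))) ∘ (Equiv.swap a b) := by
            funext i
            by_cases h1 : i = a
            · subst h1; simp [hne, hne.symm, hab]
            · by_cases h2 : i = b
              · subst h2; simp [hab]
              · simp [h1, h2, Equiv.swap_apply_of_ne_of_ne h1 h2]
          rw [hswap, AlternatingMap.map_swap _ _ hne]
          simp
        · intro c _ hc
          refine AlternatingMap.map_eq_zero_of_eq _ _ ?_ hne
          simp [Function.update_of_ne hc.1.symm, Function.update_of_ne hc.2.symm, hab]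
        · simp
        · simp }

theorem wedgeDerivation_ιMulti {M : Type*} [AddCommGroup M] [Module R M] (k : ℕ)
    (f : M →ₗ[R] M) (v : Fin k → M) :
    wedgeDerivation k f (exteriorPower.ιMulti R k v)
      = ∑ j : Fin k, exteriorPower.ιMulti R k (Function.update v j (f (v j))) := by
  rw [wedgeDerivation, exteriorPower.alternatingMapLinearEquiv_apply_ιMulti]
  change (∑ j : Fin k, (exteriorPower.ιMulti R k (M := M)).toMultilinearMap.compLinearMap
        (Function.update (fun _ => LinearMap.id) j f)) v = _
  rw [sum_apply]
  refine Finset.sum_congr rfl fun j _ => ?_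
  rw [MultilinearMap.compLinearMap_apply]
  change exteriorPower.ιMulti R k _ = _
  congr 1
  funext i
  by_cases h : i = j
  · subst h; simp
  · simp [h]

/-- The space `⨂ᵢ ⋀^{k i} Rⁿ`. -/
abbrev WedgeTensor (R : Type*) [CommRing R] (n : ℕ) {l : ℕ} (k : Fin l → ℕ) : Type _ :=
  ⨂[R] i : Fin l, (⋀[R]^(k i) (Fin n → R))

/-- The operator `A` on `⨂ᵢ ⋀^{k i} Rⁿ` defined by the matrices `A i`: the sum over `i` of the
derivation induced by `A i` acting on the `i`-th tensor factor. -/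
def tensorOp (k : Fin l → ℕ) (A : Fin l → Matrix (Fin n) (Fin n) R) :
    WedgeTensor R n k →ₗ[R] WedgeTensor R n k :=
  ∑ i : Fin l, PiTensorProduct.map
    (Function.update (fun _ => LinearMap.id) i (wedgeDerivation (k i) (Matrix.toLin' (A i))))

/-- The defining formula of the operator on decomposable tensors. -/
theorem tensorOp_tprod_ιMulti (k : Fin l → ℕ) (A : Fin l → Matrix (Fin n) (Fin n) R)
    (v : ∀ i, Fin (k i) → Fin n → R) :
    tensorOp k A (⨂ₜ[R] i, exteriorPower.ιMulti R (k i) (v i))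
      = ∑ i : Fin l, ∑ j : Fin (k i), ⨂ₜ[R] p, exteriorPower.ιMulti R (k p)
          (Function.update v i (Function.update (v i) j ((A i).mulVec (v i j))) p) := by
  rw [tensorOp, LinearMap.sum_apply]
  refine Finset.sum_congr rfl fun i _ => ?_
  rw [PiTensorProduct.map_tprod]
  have h1 : (fun p => (Function.update (fun _ => LinearMap.id) i
      (wedgeDerivation (k i) (Matrix.toLin' (A i))) :
        ∀ p, (⋀[R]^(k p) (Fin n → R)) →ₗ[R] (⋀[R]^(k p) (Fin n → R))) p
        (exteriorPower.ιMulti R (k p) (v p)))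
      = Function.update (fun p => exteriorPower.ιMulti R (k p) (v p)) i
          (∑ j : Fin (k i), exteriorPower.ιMulti R (k i)
            (Function.update (v i) j ((A i).mulVec (v i j)))) := by
    funext p
    by_cases h : p = i
    · subst h
      simp [wedgeDerivation_ιMulti]
    · simp [h]
  rw [h1, MultilinearMap.map_update_sum]
  refine Finset.sum_congr rfl fun j _ => ?_
  congr 1
  funext p
  by_cases h : p = i
  · subst h; simp
  · simp [h]

/-- The linear functional `w̄` on `⨂ᵢ ⋀^{k i} Rⁿ` with
`w̄ (⨂ᵢ v_{i,1} ∧ ⋯ ∧ v_{i,k i}) = det (v_{1,1}, …, v_{l,k l})` when `∑ i, k i = n`: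
multiply the tensor factors in the exterior algebra and apply the determinant to the component
of degree `n`.  See `wBar_tprod_ιMulti`. -/
def wBar (k : Fin l → ℕ) : WedgeTensor R n k →ₗ[R] R :=
  (ExteriorAlgebra.liftAlternating (R := R) (M := Fin n → R) (N := R)
    (Pi.single n (Matrix.detRowAlternating (n := Fin n) (R := R)))) ∘ₗ
  PiTensorProduct.lift
    ((MultilinearMap.mkPiAlgebraFin R l (ExteriorAlgebra R (Fin n → R))).compLinearMap
      (fun i => (⋀[R]^(k i) (Fin n → R)).subtype))

/-- An ordered product over a concatenated index set is the iterated ordered product. -/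
theorem list_prod_ofFn_sigma {M : Type*} [Monoid M] : ∀ (l : ℕ) (k : Fin l → ℕ)
    (g : Fin (∑ i, k i) → M),
    (List.ofFn g).prod
      = (List.ofFn fun i => (List.ofFn fun j => g (finSigmaFinEquiv ⟨i, j⟩)).prod).prod := by
  intro l
  induction l with
  | zero => intro k g; rw [List.ofFn_congr (Fin.sum_univ_zero k)]; simp
  | succ l ih =>
    intro k g
    have h := Fin.sum_univ_castSucc k
    rw [List.ofFn_congr h g, List.ofFn_add, List.prod_append, ih, List.ofFn_succ_last,
      List.prod_append]
    congr 1
    · congr 2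
      funext i
      congr 2
      funext j
      congr 1
      apply Fin.ext
      simp [finSigmaFinEquiv_apply]
    · simp only [List.prod_cons, List.prod_nil, mul_one]
      congr 2
      funext j
      congr 1
      apply Fin.ext
      simp [finSigmaFinEquiv_apply]
      rfl

theorem wBar_tprod_ιMulti (k : Fin l → ℕ) (hk : ∑ i, k i = n) (v : ∀ i, Fin (k i) → Fin n → R) :
    wBar k (⨂ₜ[R] i, exteriorPower.ιMulti R (k i) (v i))
      = Matrix.det (Matrix.of fun a : Fin n =>
          v (finSigmaFinEquiv.symm (Fin.cast hk.symm a)).1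
            (finSigmaFinEquiv.symm (Fin.cast hk.symm a)).2) := by
  subst hk
  have h1 : ((PiTensorProduct.lift
      ((MultilinearMap.mkPiAlgebraFin R l
          (ExteriorAlgebra R (Fin (∑ i, k i) → R))).compLinearMap
        (fun i => (⋀[R]^(k i) (Fin (∑ i, k i) → R)).subtype)))
      (⨂ₜ[R] i, exteriorPower.ιMulti R (k i) (v i)))
      = ExteriorAlgebra.ιMulti R (∑ i, k i) (fun a =>
          v (finSigmaFinEquiv.symm a).1 (finSigmaFinEquiv.symm a).2) := by
    rw [PiTensorProduct.lift.tprod]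
    simp only [MultilinearMap.compLinearMap_apply, MultilinearMap.mkPiAlgebraFin_apply,
      Submodule.subtype_apply, exteriorPower.ιMulti_apply_coe, ExteriorAlgebra.ιMulti_apply]
    rw [list_prod_ofFn_sigma]
    congr 2
    funext i
    congr 2
    funext j
    rw [Equiv.symm_apply_apply]
  rw [wBar, LinearMap.comp_apply, h1, ExteriorAlgebra.liftAlternating_apply_ιMulti,
    Pi.single_eq_same]
  rfl

/-- The standard basis of `⨂ᵢ ⋀^{k i} Rⁿ`, indexed by the families `S` of subsets of
`{1, …, n}` with `|S i| = k i`. -/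
def stdBasis (R : Type*) [CommRing R] (n : ℕ) (k : Fin l → ℕ) :
    Module.Basis (∀ i, Set.powersetCard (Fin n) (k i)) R (WedgeTensor R n k) :=
  Basis.piTensorProduct fun i => (Pi.basisFun R (Fin n)).exteriorPower (k i)

/-- An enumeration of the index set of the standard basis. Another enumeration changes the
determinant below only by a sign. -/
def indexEquiv (n : ℕ) (k : Fin l → ℕ) :
    Fin (∏ i, n.choose (k i)) ≃ (∀ i, Set.powersetCard (Fin n) (k i)) :=
  (Finite.equivFinOfCardEq (by simp only [Nat.card_pi, Set.powersetCard.card, Nat.card_fin])).symm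

/-- The matrix with rows `w̄, w̄ A, …, w̄ A^(N-1)`, where `N = ∏ i, n.choose (k i)`. -/
def krylovMatrix (k : Fin l → ℕ) (A : Fin l → Matrix (Fin n) (Fin n) R) :
    Matrix (Fin (∏ i, n.choose (k i))) (Fin (∏ i, n.choose (k i))) R :=
  Matrix.of fun r c => (wBar k ∘ₗ (tensorOp k A ^ (r : ℕ))) (stdBasis R n k (indexEquiv n k c))

end Operators

/-- The ring of complex polynomials in the entries of `l` matrices of size `n × n`; the variable
`(i, a, b)` is the `(a, b)` entry of the `i`-th matrix. -/
abbrev EntryPoly (n l : ℕ) : Type := MvPolynomial (Fin l × Fin n × Fin n) ℂ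

/-- The `i`-th generic matrix. -/
def genericMatrix (n l : ℕ) (i : Fin l) : Matrix (Fin n) (Fin n) (EntryPoly n l) :=
  Matrix.of fun a b => MvPolynomial.X (i, a, b)

/-- The Krylov determinant `P`, as a polynomial in the entries of the matrices. -/
def krylovDet (n : ℕ) {l : ℕ} (k : Fin l → ℕ) : EntryPoly n l :=
  (krylovMatrix k (genericMatrix n l)).det

/-- The pairs `(F, G)` of families of subsets of `{1, …, n}` with `|F i| = |G i| = k' i` and
`F i ∩ G i = ∅` for all `i`. -/
def disjointPairs (n : ℕ) {l : ℕ} (k' : Fin l → ℕ) :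
    Finset ((Fin l → Finset (Fin n)) × (Fin l → Finset (Fin n))) :=
  Finset.univ.filter fun p =>
    ∀ i, (p.1 i).card = k' i ∧ (p.2 i).card = k' i ∧ Disjoint (p.1 i) (p.2 i)

/-- `d` is the polynomial `d_{k'}` in the entries of the matrices: whenever `lam i` lists the
eigenvalues of `A i` with multiplicity, the value of `d` at `A` is
`∏_{(F, G)} ∑ i, (∑_{j ∈ F i} lam i j - ∑_{j ∈ G i} lam i j)`. There is at most one such `d`. -/
def IsEigenvalueProduct (n : ℕ) {l : ℕ} (k' : Fin l → ℕ) (d : EntryPoly n l) : Prop :=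
  ∀ (A : Fin l → Matrix (Fin n) (Fin n) ℂ) (lam : Fin l → Fin n → ℂ),
    (∀ i, (A i).charpoly = ∏ j, (Polynomial.X - Polynomial.C (lam i j))) →
    MvPolynomial.eval (fun x : Fin l × Fin n × Fin n => A x.1 x.2.1 x.2.2) d
      = ∏ p ∈ disjointPairs n k',
          ∑ i, (∑ j ∈ p.1 i, lam i j - ∑ j ∈ p.2 i, lam i j)

end KrylovTuple

end

/-! Suppose `A i = U i * diagonal (x i) * V i` with `U i * V i = 1`. Wedges of columns of the `U i`,
tensored together, form an eigenbasis of the operator, with eigenvalues `familySum x S`. Evaluating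
the rows of the Krylov matrix on this basis gives a transposed Vandermonde matrix times a diagonal
one, so the Vandermonde determinant of the eigenvalues divides the Krylov determinant
(`vandermonde_dvd_det_krylovMatrix`). A disjoint pair `(F, G)` and a completion `C` give the
eigenvalue difference of `F ∪ C` and `G ∪ C`, which is the form of `(F, G)`. Counting completions
shows that the required power of the product of forms divides the squared Vandermonde determinant
(`pairProduct_pow_dvd_vandermonde_sq`).

This proves divisibility in the variables `x`, after every substitution `conjHom U V`. It descends
to the matrix entries by the Nullstellensatz (`IsBlockDiscriminant.dvd_of_conjHom_dvd`): where the
discriminant `Δ` is nonzero every tuple is diagonalizable, and `d` has no irreducible factor in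
common with `Δ`. The last point uses `∑ k' > 1`: each form then involves at least four variables, so
it does not vanish on a hyperplane `x (i, a) = x (i, b)`. The same fact makes the square root of the
product of forms symmetric in each block, hence a polynomial in the entries. -/

noncomputable section

namespace KrylovTuple

/-! ### Base change and the eigenbasis of the operator. -/

section LinearAlgebra

variable {R R' : Type*} [CommRing R] [CommRing R'] {n l : ℕ}

theorem stdBasis_apply (k : Fin l → ℕ) (S : ∀ i, Set.powersetCard (Fin n) (k i)) :
    stdBasis R n k S = ⨂ₜ[R] i, exteriorPower.ιMulti R (k i)
      (fun j => (Pi.single (Set.powersetCard.ofFinEmbEquiv.symm (S i) j) 1 : Fin n → R)) := by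
  rw [stdBasis, Basis.piTensorProduct_apply]
  congr 1
  funext i
  rw [exteriorPower.basis_apply]
  simp only [exteriorPower.ιMulti_family]
  congr 1
  funext j
  simp

theorem stdBasis_repr_tprod (k : Fin l → ℕ) (v : ∀ i, Fin (k i) → Fin n → R)
    (T : ∀ i, Set.powersetCard (Fin n) (k i)) :
    (stdBasis R n k).repr (⨂ₜ[R] i, exteriorPower.ιMulti R (k i) (v i)) T
      = ∏ i, (Matrix.of fun a b => v i a (Set.powersetCard.ofFinEmbEquiv.symm (T i) b)).det := by
  rw [stdBasis, Basis.piTensorProduct_repr_tprod_apply]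
  refine Finset.prod_congr rfl fun i _ => ?_
  rw [exteriorPower.basis_repr_apply, exteriorPower.ιMultiDual_apply_ιMulti]
  simp

theorem stdBasis_repr_tprod_map (φ : R →+* R') (k : Fin l → ℕ) (v : ∀ i, Fin (k i) → Fin n → R)
    (T : ∀ i, Set.powersetCard (Fin n) (k i)) :
    φ ((stdBasis R n k).repr (⨂ₜ[R] i, exteriorPower.ιMulti R (k i) (v i)) T)
      = (stdBasis R' n k).repr
          (⨂ₜ[R'] i, exteriorPower.ιMulti R' (k i) (fun a b => φ (v i a b))) T := by
  simp only [stdBasis_repr_tprod, map_prod, RingHom.map_det]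
  rfl

/-- The matrix of `tensorOp k A` in the standard basis. -/
def tensorOpMatrix (k : Fin l → ℕ) (A : Fin l → Matrix (Fin n) (Fin n) R) :
    Matrix (∀ i, Set.powersetCard (Fin n) (k i)) (∀ i, Set.powersetCard (Fin n) (k i)) R :=
  LinearMap.toMatrix (stdBasis R n k) (stdBasis R n k) (tensorOp k A)

theorem tensorOpMatrix_map (φ : R →+* R') (k : Fin l → ℕ)
    (A : Fin l → Matrix (Fin n) (Fin n) R) :
    tensorOpMatrix k (fun i => (A i).map φ) = (tensorOpMatrix k A).map φ := by
  ext T S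
  rw [Matrix.map_apply, tensorOpMatrix, tensorOpMatrix, LinearMap.toMatrix_apply,
    LinearMap.toMatrix_apply, stdBasis_apply, stdBasis_apply, tensorOp_tprod_ιMulti,
    tensorOp_tprod_ιMulti]
  simp only [map_sum, Finsupp.coe_finsetSum, Finset.sum_apply, stdBasis_repr_tprod_map]
  refine Finset.sum_congr rfl fun i _ => Finset.sum_congr rfl fun j _ => ?_
  congr 3
  funext p
  congr 1
  funext a b
  by_cases hp : p = i
  · subst hp
    by_cases ha : a = j
    · subst ha
      simp
    · simp [ha, Pi.single_apply, apply_ite φ]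
  · simp [hp, Pi.single_apply, apply_ite φ]

theorem wBar_stdBasis_map (φ : R →+* R') (k : Fin l → ℕ) (hk : ∑ i, k i = n)
    (S : ∀ i, Set.powersetCard (Fin n) (k i)) :
    φ (wBar k (stdBasis R n k S)) = wBar k (stdBasis R' n k S) := by
  rw [stdBasis_apply, stdBasis_apply, wBar_tprod_ιMulti k hk, wBar_tprod_ιMulti k hk,
    RingHom.map_det]
  congr 1
  ext a b
  simp [Pi.single_apply, apply_ite φ]

theorem krylovMatrix_apply (k : Fin l → ℕ) (A : Fin l → Matrix (Fin n) (Fin n) R)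
    (r c : Fin (∏ i, n.choose (k i))) :
    krylovMatrix k A r c = ∑ T, (tensorOpMatrix k A ^ (r : ℕ)) T (indexEquiv n k c)
      * wBar k (stdBasis R n k T) := by
  have hpow : tensorOpMatrix k A ^ (r : ℕ)
      = LinearMap.toMatrix (stdBasis R n k) (stdBasis R n k) (tensorOp k A ^ (r : ℕ)) :=
    (LinearMap.toMatrix_pow _ _ _)
  rw [hpow, krylovMatrix, Matrix.of_apply, LinearMap.comp_apply,
    ← (stdBasis R n k).sum_repr ((tensorOp k A ^ (r : ℕ)) (stdBasis R n k (indexEquiv n k c))),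
    map_sum]
  refine Finset.sum_congr rfl fun T _ => ?_
  rw [map_smul, smul_eq_mul, LinearMap.toMatrix_apply]

/-- In standard coordinates both the operator and `wBar` are given by determinants, which commute
with ring homomorphisms. This permits substitution into the generic matrices. -/
theorem krylovMatrix_map (φ : R →+* R') (k : Fin l → ℕ) (hk : ∑ i, k i = n)
    (A : Fin l → Matrix (Fin n) (Fin n) R) :
    krylovMatrix k (fun i => (A i).map φ) = (krylovMatrix k A).map φ := by
  ext r c
  rw [Matrix.map_apply, krylovMatrix_apply, krylovMatrix_apply, tensorOpMatrix_map, map_sum,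
    ← Matrix.map_pow]
  simp only [map_mul, Matrix.map_apply, wBar_stdBasis_map φ k hk]

/-- The decomposable tensor attached to the columns of the matrices `U i` with index in `S i`. -/
def columnTensor (k : Fin l → ℕ) (U : Fin l → Matrix (Fin n) (Fin n) R)
    (S : ∀ i, Set.powersetCard (Fin n) (k i)) : WedgeTensor R n k :=
  PiTensorProduct.map (fun i => exteriorPower.map (k i) (Matrix.toLin' (U i))) (stdBasis R n k S)

theorem columnTensor_eq (k : Fin l → ℕ) (U : Fin l → Matrix (Fin n) (Fin n) R)
    (S : ∀ i, Set.powersetCard (Fin n) (k i)) :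
    columnTensor k U S = ⨂ₜ[R] i, exteriorPower.ιMulti R (k i)
      (fun j => (U i).col (Set.powersetCard.ofFinEmbEquiv.symm (S i) j)) := by
  rw [columnTensor, stdBasis_apply, PiTensorProduct.map_tprod]
  congr 1
  funext i
  rw [exteriorPower.map_apply_ιMulti]
  congr 1
  funext j
  simp

/-- The eigenvalue of `tensorOp` attached to a family of subsets. -/
def familySum (x : Fin l → Fin n → R) (S : Fin l → Finset (Fin n)) : R :=
  ∑ i, ∑ j ∈ S i, x i j

/-- Each column of `U i` is an eigenvector of `A i`, and a derivation adds up the eigenvalues of the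
wedge factors. -/
theorem tensorOp_columnTensor (k : Fin l → ℕ) (A U : Fin l → Matrix (Fin n) (Fin n) R)
    (x : Fin l → Fin n → R) (h : ∀ i, A i * U i = U i * Matrix.diagonal (x i))
    (S : ∀ i, Set.powersetCard (Fin n) (k i)) :
    tensorOp k A (columnTensor k U S)
      = familySum x (fun i => (S i : Finset (Fin n))) • columnTensor k U S := by
  rw [columnTensor_eq, tensorOp_tprod_ιMulti, familySum, Finset.sum_smul]
  refine Finset.sum_congr rfl fun i _ => ?_
  have hcol : ∀ a, (A i).mulVec ((U i).col a) = x i a • (U i).col a := by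
    intro a
    have := congrArg (fun M : Matrix (Fin n) (Fin n) R => M.col a) (h i)
    funext b
    have := congrFun this b
    simp only [Matrix.col_apply, Matrix.mul_diagonal] at this
    simpa [Matrix.mul_apply, Matrix.mulVec, dotProduct, mul_comm] using this
  have hsum : ∑ j ∈ (S i : Finset (Fin n)), x i j
      = ∑ j, x i (Set.powersetCard.ofFinEmbEquiv.symm (S i) j) := by
    have hS : (S i).val.card = k i := (S i).prop
    refine Eq.trans ?_ (Finset.sum_map Finset.univ
      (Finset.orderEmbOfFin (S i).val hS).toEmbedding (x i))
    rw [Finset.map_orderEmbOfFin_univ _ hS]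
  rw [hsum, Finset.sum_smul]
  refine Finset.sum_congr rfl fun j _ => ?_
  rw [hcol]
  have h1 : (fun p => exteriorPower.ιMulti R (k p)
      (Function.update (fun i j => (U i).col (Set.powersetCard.ofFinEmbEquiv.symm (S i) j)) i
        (Function.update (fun j => (U i).col (Set.powersetCard.ofFinEmbEquiv.symm (S i) j)) j
          (x i (Set.powersetCard.ofFinEmbEquiv.symm (S i) j) •
            (U i).col (Set.powersetCard.ofFinEmbEquiv.symm (S i) j))) p))
      = Function.update (fun p => exteriorPower.ιMulti R (k p)
          (fun j => (U p).col (Set.powersetCard.ofFinEmbEquiv.symm (S p) j))) i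
          (x i (Set.powersetCard.ofFinEmbEquiv.symm (S i) j) •
            exteriorPower.ιMulti R (k i)
              (fun j => (U i).col (Set.powersetCard.ofFinEmbEquiv.symm (S i) j))) := by
    funext p
    by_cases hp : p = i
    · subst hp
      simp only [Function.update_self]
      rw [AlternatingMap.map_update_smul, Function.update_eq_self]
    · simp [hp]
  rw [h1, MultilinearMap.map_update_smul, Function.update_eq_self]

/-- By functoriality the map induced by the `V i` is a right inverse of the one induced by the `U
i`, so the column tensors form a basis over any commutative ring. -/
theorem isUnit_det_columnTensor (k : Fin l → ℕ) (U V : Fin l → Matrix (Fin n) (Fin n) R)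
    (h : ∀ i, U i * V i = 1) :
    IsUnit (Matrix.of fun T S => (stdBasis R n k).repr (columnTensor k U S) T).det := by
  have hcomp : PiTensorProduct.map (fun i => exteriorPower.map (k i) (Matrix.toLin' (U i))) ∘ₗ
      PiTensorProduct.map (fun i => exteriorPower.map (k i) (Matrix.toLin' (V i)))
        = LinearMap.id := by
    rw [← PiTensorProduct.map_comp, ← PiTensorProduct.map_id]
    congr 1
    funext i
    rw [← exteriorPower.map_comp, ← Matrix.toLin'_mul, h i, Matrix.toLin'_one,
      exteriorPower.map_id]
  have hM : (Matrix.of fun T S => (stdBasis R n k).repr (columnTensor k U S) T)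
      = LinearMap.toMatrix (stdBasis R n k) (stdBasis R n k)
        (PiTensorProduct.map (fun i => exteriorPower.map (k i) (Matrix.toLin' (U i)))) := by
    ext T S
    rw [LinearMap.toMatrix_apply, Matrix.of_apply, columnTensor]
  rw [hM]
  refine IsUnit.of_mul_eq_one (LinearMap.toMatrix (stdBasis R n k) (stdBasis R n k)
    (PiTensorProduct.map (fun i => exteriorPower.map (k i) (Matrix.toLin' (V i))))).det ?_
  rw [← Matrix.det_mul, ← LinearMap.toMatrix_comp, hcomp, LinearMap.toMatrix_id, Matrix.det_one]

/-- The Vandermonde determinant of the eigenvalues of `tensorOp` divides the Krylov determinant of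
a diagonalized family of matrices. -/
theorem vandermonde_dvd_det_krylovMatrix (k : Fin l → ℕ) (A U V : Fin l → Matrix (Fin n) (Fin n) R)
    (x : Fin l → Fin n → R) (hUV : ∀ i, U i * V i = 1)
    (h : ∀ i, A i * U i = U i * Matrix.diagonal (x i)) :
    (Matrix.vandermonde fun c : Fin (∏ i, n.choose (k i)) =>
      familySum x (fun i => (indexEquiv n k c i : Finset (Fin n)))).det
      ∣ (krylovMatrix k A).det := by
  set μ : Fin (∏ i, n.choose (k i)) → R := fun c =>
    familySum x (fun i => (indexEquiv n k c i : Finset (Fin n))) with hμ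
  set e := indexEquiv n k
  have hunit := isUnit_det_columnTensor k U V hUV
  rw [← Matrix.det_submatrix_equiv_self e] at hunit
  -- An invertible change of basis does not affect divisibility, so the functionals may be evaluated
  -- on the eigenbasis.
  refine (hunit.dvd_mul_right).1 ?_
  rw [← Matrix.det_mul]
  have hpow : ∀ (r : ℕ) (S), (tensorOp k A ^ r) (columnTensor k U S)
      = familySum x (fun i => (S i : Finset (Fin n))) ^ r • columnTensor k U S := by
    intro r S
    induction r with
    | zero => simp
    | succ r ih =>
      rw [pow_succ', Module.End.mul_apply, ih, map_smul, tensorOp_columnTensor k A U x h,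
        smul_smul, pow_succ]
  have hprod : krylovMatrix k A * (Matrix.of fun T S =>
        (stdBasis R n k).repr (columnTensor k U S) T).submatrix e e
      = (Matrix.vandermonde μ).transpose
        * Matrix.diagonal fun c => wBar k (columnTensor k U (e c)) := by
    ext r c
    rw [Matrix.mul_diagonal, Matrix.transpose_apply, Matrix.vandermonde_apply, Matrix.mul_apply]
    have h1 := congrArg (wBar k) (hpow r (e c))
    rw [map_smul, smul_eq_mul] at h1
    rw [hμ, ← h1]
    conv_rhs => rw [← (stdBasis R n k).sum_repr (columnTensor k U (e c)), map_sum, map_sum]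
    rw [← Equiv.sum_comp e]
    refine Finset.sum_congr rfl fun T _ => ?_
    rw [map_smul, map_smul, smul_eq_mul, mul_comm]
    rfl
  rw [hprod, Matrix.det_mul, Matrix.det_transpose]
  exact dvd_mul_right _ _

end LinearAlgebra

/-! ### From block-symmetric polynomials in the eigenvalues to polynomials in the entries. -/

section Symmetrization

open MvPolynomial

variable {n l : ℕ}

theorem exists_eigenvalues (A : Matrix (Fin n) (Fin n) ℂ) :
    ∃ lam : Fin n → ℂ, A.charpoly = ∏ j, (Polynomial.X - Polynomial.C (lam j)) := by
  have hs : A.charpoly.Splits := IsAlgClosed.splits _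
  have hcard : A.charpoly.roots.toList.length = n := by
    rw [Multiset.length_toList, ← hs.natDegree_eq_card_roots, Matrix.charpoly_natDegree_eq_dim,
      Fintype.card_fin]
  refine ⟨fun j => A.charpoly.roots.toList.get (Fin.cast hcard.symm j), ?_⟩
  have h1 := hs.eq_prod_roots_of_monic A.charpoly_monic
  refine h1.trans ?_
  conv_lhs => rw [← Multiset.coe_toList A.charpoly.roots]
  rw [Multiset.map_coe, Multiset.prod_coe, ← List.prod_ofFn]
  congr 1
  refine List.ext_get (by simp [hcard]) ?_
  intro m h1 h2
  simp

/-- A symmetric polynomial in the eigenvalues of the `i`-th matrix is a polynomial in its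
entries. -/
theorem exists_eval_eq_of_isSymmetric (i : Fin l) {s : MvPolynomial (Fin n) ℂ}
    (hs : s.IsSymmetric) :
    ∃ Q : EntryPoly n l, ∀ (A : Fin l → Matrix (Fin n) (Fin n) ℂ) (lam : Fin n → ℂ),
      (A i).charpoly = ∏ j, (Polynomial.X - Polynomial.C (lam j)) →
      eval (fun x : Fin l × Fin n × Fin n => A x.1 x.2.1 x.2.2) Q = eval lam s := by
  obtain ⟨q, hq⟩ := esymmAlgHom_surjective (σ := Fin n) ℂ (n := n) (by simp) ⟨s, hs⟩
  have hq' : aeval (fun j : Fin n => esymm (Fin n) ℂ (j + 1)) q = s := by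
    rw [← esymmAlgHom_apply, hq]
  -- Vieta: the coefficient of degree `n - (j + 1)` of the characteristic polynomial is `(-1) ^ (j +
  -- 1)` times the elementary symmetric polynomial of degree `j + 1`.
  refine ⟨aeval (fun j : Fin n =>
    C ((-1) ^ ((j : ℕ) + 1)) * (genericMatrix n l i).charpoly.coeff (n - (j + 1))) q, ?_⟩
  intro A lam h
  have hgen : ((genericMatrix n l i).map
      (eval (fun x : Fin l × Fin n × Fin n => A x.1 x.2.1 x.2.2))) = A i := by
    ext a b
    simp [genericMatrix]
  have hcoeff : ∀ j : Fin n, eval (fun x : Fin l × Fin n × Fin n => A x.1 x.2.1 x.2.2)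
      (C ((-1) ^ ((j : ℕ) + 1)) * (genericMatrix n l i).charpoly.coeff (n - (j + 1)))
      = eval lam (esymm (Fin n) ℂ (j + 1)) := by
    intro j
    have hj : (j : ℕ) + 1 ≤ n := j.2
    rw [map_mul, eval_C, ← Polynomial.coeff_map, ← Matrix.charpoly_map, hgen, h]
    have h1 := Multiset.prod_X_sub_C_coeff (Finset.univ.val.map lam) (k := n - (j + 1))
      (by simp)
    rw [Multiset.map_map] at h1
    have h2 : (∏ j, (Polynomial.X - Polynomial.C (lam j)))
        = (Multiset.map ((fun t => Polynomial.X - Polynomial.C t) ∘ lam) Finset.univ.val).prod :=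
      rfl
    rw [h2, h1]
    have h3 : Multiset.card (Finset.univ.val.map lam) - (n - ((j : ℕ) + 1)) = j + 1 := by
      simp
      omega
    rw [h3, ← aeval_esymm_eq_multiset_esymm (Fin n) ℂ, ← mul_assoc, ← mul_pow]
    simp
  rw [← hq', aeval_def, aeval_def, ← coe_eval₂Hom, ← coe_eval₂Hom]
  have : (eval (fun x : Fin l × Fin n × Fin n => A x.1 x.2.1 x.2.2)).comp
      (eval₂Hom (algebraMap ℂ (EntryPoly n l)) fun j : Fin n =>
        C ((-1) ^ ((j : ℕ) + 1)) * (genericMatrix n l i).charpoly.coeff (n - (j + 1)))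
      = (eval lam).comp (eval₂Hom (algebraMap ℂ (MvPolynomial (Fin n) ℂ))
        fun j : Fin n => esymm (Fin n) ℂ (j + 1)) := by
    apply MvPolynomial.ringHom_ext
    · intro c
      simp [MvPolynomial.algebraMap_eq]
    · intro j
      simpa using hcoeff j
  exact RingHom.congr_fun this q

/-- The permutation of the variables `(i, j)` given by permutations of each block. -/
def blockPerm (σ : Fin l → Equiv.Perm (Fin n)) (x : Fin l × Fin n) : Fin l × Fin n :=
  (x.1, σ x.1 x.2)

/-- A polynomial in the eigenvalues, symmetric in each block, is a polynomial in the entries of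
the matrices. -/
theorem exists_eval_eq_of_blockSymmetric {p : MvPolynomial (Fin l × Fin n) ℂ}
    (hp : ∀ σ : Fin l → Equiv.Perm (Fin n), rename (blockPerm σ) p = p) :
    ∃ Q : EntryPoly n l, ∀ (A : Fin l → Matrix (Fin n) (Fin n) ℂ) (lam : Fin l → Fin n → ℂ),
      (∀ i, (A i).charpoly = ∏ j, (Polynomial.X - Polynomial.C (lam i j))) →
      eval (fun x : Fin l × Fin n × Fin n => A x.1 x.2.1 x.2.2) Q
        = eval (fun x => lam x.1 x.2) p := by
  classical
  have hs : ∀ (i : Fin l) (m : Fin l × Fin n →₀ ℕ),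
      (∑ τ : Equiv.Perm (Fin n), ∏ j, (X (τ j) : MvPolynomial (Fin n) ℂ) ^ m (i, j)).IsSymmetric := by
    intro i m e
    rw [map_sum]
    refine Fintype.sum_equiv (Equiv.mulLeft e) _ _ fun τ => ?_
    simp [map_prod]
  choose Q hQ using fun (i : Fin l) (m : Fin l × Fin n →₀ ℕ) =>
    exists_eval_eq_of_isSymmetric (n := n) i (hs i m)
  -- `p` is the average of its block permutations. The sum of a monomial over all block permutations
  -- factors into one symmetric polynomial per block, represented by `Q i m`.
  refine ⟨C ((Fintype.card (Fin l → Equiv.Perm (Fin n)) : ℂ)⁻¹) *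
    ∑ m ∈ p.support, C (coeff m p) * ∏ i, Q i m, ?_⟩
  intro A lam h
  have hcard : (Fintype.card (Fin l → Equiv.Perm (Fin n)) : ℂ) ≠ 0 := by
    exact_mod_cast Fintype.card_ne_zero
  rw [map_mul, eval_C, inv_mul_eq_iff_eq_mul₀ hcard]
  have h1 : (Fintype.card (Fin l → Equiv.Perm (Fin n)) : ℂ) * eval (fun x => lam x.1 x.2) p
      = ∑ σ : Fin l → Equiv.Perm (Fin n), eval (fun x => lam x.1 (σ x.1 x.2)) p := by
    rw [← nsmul_eq_mul, ← Finset.card_univ, ← Finset.sum_const]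
    refine Finset.sum_congr rfl fun σ _ => ?_
    conv_lhs => rw [← hp σ, eval_rename]
    rfl
  rw [h1, map_sum]
  have h2 : ∀ σ : Fin l → Equiv.Perm (Fin n), eval (fun x => lam x.1 (σ x.1 x.2)) p
      = ∑ m ∈ p.support, coeff m p * ∏ x, lam x.1 (σ x.1 x.2) ^ m x := fun _ => eval_eq' _ _
  simp only [h2]
  rw [Finset.sum_comm]
  refine Finset.sum_congr rfl fun m _ => ?_
  rw [map_mul, eval_C, map_prod, ← Finset.mul_sum]
  congr 1
  simp only [hQ _ m A _ (h _), map_sum, map_prod, map_pow, eval_X]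
  rw [Finset.prod_univ_sum, Fintype.piFinset_univ]
  refine Finset.sum_congr rfl fun σ _ => ?_
  rw [Fintype.prod_prod_type]

end Symmetrization

/-! ### The linear forms of disjoint pairs, their product and its square root. -/

section PairForms

open MvPolynomial

variable {n l : ℕ}

/-- The linear form `∑ i, (∑_{j ∈ F i} X (i, j) - ∑_{j ∈ G i} X (i, j))`. -/
def pairForm (p : (Fin l → Finset (Fin n)) × (Fin l → Finset (Fin n))) :
    MvPolynomial (Fin l × Fin n) ℂ :=
  ∑ i, (∑ j ∈ p.1 i, X (i, j) - ∑ j ∈ p.2 i, X (i, j))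

theorem eval_pairForm (x : Fin l × Fin n → ℂ)
    (p : (Fin l → Finset (Fin n)) × (Fin l → Finset (Fin n))) :
    eval x (pairForm p) = ∑ i, (∑ j ∈ p.1 i, x (i, j) - ∑ j ∈ p.2 i, x (i, j)) := by
  simp [pairForm]

theorem pairForm_swap (p : (Fin l → Finset (Fin n)) × (Fin l → Finset (Fin n))) :
    pairForm p.swap = - pairForm p := by
  simp [pairForm]

theorem swap_mem_disjointPairs {k' : Fin l → ℕ}
    {p : (Fin l → Finset (Fin n)) × (Fin l → Finset (Fin n))} (hp : p ∈ disjointPairs n k') :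
    p.swap ∈ disjointPairs n k' := by
  simp only [disjointPairs, Finset.mem_filter, Finset.mem_univ, true_and] at hp ⊢
  exact fun i => ⟨(hp i).2.1, (hp i).1, (hp i).2.2.symm⟩

theorem swap_ne_of_mem_disjointPairs {k' : Fin l → ℕ} (hsum : 1 < ∑ i, k' i)
    {p : (Fin l → Finset (Fin n)) × (Fin l → Finset (Fin n))} (hp : p ∈ disjointPairs n k') :
    p.swap ≠ p := by
  intro h
  simp only [disjointPairs, Finset.mem_filter, Finset.mem_univ, true_and] at hp
  have h2 : p.2 = p.1 := congrArg Prod.fst h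
  have : ∑ i, k' i = 0 := by
    refine Finset.sum_eq_zero fun i _ => ?_
    obtain ⟨h1, -, h3⟩ := hp i
    rw [h2, disjoint_self] at h3
    rw [← h1, h3]
    rfl
  omega

/-- A form attached to a disjoint pair does not vanish on the hyperplane `X (i, a) = X (i, b)`. -/
theorem exists_eval_pairForm_ne_zero {k' : Fin l → ℕ} (hsum : 1 < ∑ i, k' i)
    {p : (Fin l → Finset (Fin n)) × (Fin l → Finset (Fin n))} (hp : p ∈ disjointPairs n k')
    (i : Fin l) (a b : Fin n) :
    ∃ x : Fin l × Fin n → ℂ, x (i, a) = x (i, b) ∧ eval x (pairForm p) ≠ 0 := by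
  classical
  simp only [disjointPairs, Finset.mem_filter, Finset.mem_univ, true_and] at hp
  -- `W` is the set of variables occurring in the form, each with coefficient `1` or `-1` by
  -- disjointness. It has at least four elements, so it contains a `y` other than `(i, a)` and `(i,
  -- b)`; the indicator of `y` is the required point.
  set W : Finset (Fin l × Fin n) := Finset.univ.filter fun y => y.2 ∈ p.1 y.1 ∪ p.2 y.1 with hW
  have hWcard : W.card = ∑ i, (k' i + k' i) := by
    rw [hW, Finset.card_filter, Fintype.sum_prod_type]
    refine Finset.sum_congr rfl fun i _ => ?_
    obtain ⟨h1, h2, h3⟩ := hp i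
    rw [← Finset.card_filter]
    simp only [Finset.filter_univ_mem]
    rw [Finset.card_union_of_disjoint h3, h1, h2]
  rw [Finset.sum_add_distrib] at hWcard
  have h2 : ({(i, a), (i, b)} : Finset (Fin l × Fin n)).card ≤ 2 := Finset.card_le_two
  obtain ⟨y, hyW, hy⟩ := Finset.exists_mem_notMem_of_card_lt_card
    (s := {(i, a), (i, b)}) (t := W) (by omega)
  simp only [Finset.mem_insert, Finset.mem_singleton, not_or] at hy
  refine ⟨fun z => if z = y then 1 else 0, ?_, ?_⟩
  · simp [Ne.symm hy.1, Ne.symm hy.2]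
  · rw [eval_pairForm]
    rw [Finset.sum_eq_single y.1]
    · have hiff : ∀ j, (y.1, j) = y ↔ j = y.2 := fun j => by simp [Prod.ext_iff]
      simp only [hiff, Finset.sum_ite_eq']
      simp only [hW, Finset.mem_filter, Finset.mem_univ, true_and, Finset.mem_union] at hyW
      have hd := (hp y.1).2.2
      rcases hyW with h | h
      · simp [h, Finset.disjoint_left.1 hd h]
      · simp [h, Finset.disjoint_right.1 hd h]
    · intro i' _ hi'
      have hne : ∀ j, (i', j) ≠ y := fun j h => hi' (congrArg Prod.fst h)
      simp [hne]
    · simp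

/-- The product of the forms attached to all disjoint pairs. -/
def pairProduct (n : ℕ) {l : ℕ} (k' : Fin l → ℕ) : MvPolynomial (Fin l × Fin n) ℂ :=
  ∏ p ∈ disjointPairs n k', pairForm p

theorem rename_pairProduct (k' : Fin l → ℕ) (σ : Fin l → Equiv.Perm (Fin n)) :
    rename (blockPerm σ) (pairProduct n k') = pairProduct n k' := by
  rw [pairProduct, map_prod]
  refine Finset.prod_nbij'
    (fun p => (fun i => (p.1 i).map (σ i).toEmbedding, fun i => (p.2 i).map (σ i).toEmbedding))
    (fun p => (fun i => (p.1 i).map (σ i).symm.toEmbedding,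
      fun i => (p.2 i).map (σ i).symm.toEmbedding)) ?_ ?_ ?_ ?_ ?_
  · intro p hp
    simpa [disjointPairs] using hp
  · intro p hp
    simpa [disjointPairs] using hp
  · intro p _
    ext <;> simp
  · intro p _
    ext <;> simp
  · intro p _
    simp [pairForm, blockPerm]

/-- A product over a finite set with a fixed point free involution that changes the sign of the
factors is a square. -/
theorem exists_sq_eq_prod_of_involution {α S : Type*} [Finite α] [CommRing S] [Algebra ℂ S]
    (s : Finset α) (g : α → α) (hg : ∀ x, g (g x) = x) (hmem : ∀ x ∈ s, g x ∈ s)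
    (hne : ∀ x ∈ s, g x ≠ x) (f : α → S) (hf : ∀ x, f (g x) = - f x) :
    ∃ q : S, q ^ 2 = ∏ x ∈ s, f x := by
  classical
  obtain ⟨m, ⟨e⟩⟩ := Finite.exists_equiv_fin α
  have hneg : ∏ x ∈ s with ¬ e x < e (g x), f x = ∏ x ∈ s with e x < e (g x), - f x := by
    refine Finset.prod_nbij' g g ?_ ?_ ?_ ?_ ?_
    · intro x hx
      simp only [Finset.mem_filter, not_lt] at hx ⊢
      refine ⟨hmem x hx.1, ?_⟩
      rw [hg]
      exact lt_of_le_of_ne hx.2 fun h => hne x hx.1 (e.injective h)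
    · intro x hx
      simp only [Finset.mem_filter, not_lt] at hx ⊢
      refine ⟨hmem x hx.1, ?_⟩
      rw [hg]
      exact hx.2.le
    · exact fun x _ => hg x
    · exact fun x _ => hg x
    · intro x _
      rw [hf, neg_neg]
  -- The enumeration `e` selects one element of each orbit. The two factors of an orbit multiply to
  -- minus a square, and the power of `I` absorbs these signs.
  refine ⟨algebraMap ℂ S (Complex.I ^ (s.filter fun x => e x < e (g x)).card) *
    ∏ x ∈ s with e x < e (g x), f x, ?_⟩
  rw [← Finset.prod_filter_mul_prod_filter_not s (fun x => e x < e (g x)) f, hneg,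
    Finset.prod_neg, mul_pow, ← map_pow, ← pow_mul, mul_comm _ 2, pow_mul, Complex.I_sq,
    map_pow, map_neg, map_one]
  ring

theorem exists_sq_eq_pairProduct {k' : Fin l → ℕ} (hsum : 1 < ∑ i, k' i) :
    ∃ q : MvPolynomial (Fin l × Fin n) ℂ, q ^ 2 = pairProduct n k' :=
  exists_sq_eq_prod_of_involution (disjointPairs n k') Prod.swap Prod.swap_swap
    (fun _ => swap_mem_disjointPairs) (fun _ => swap_ne_of_mem_disjointPairs hsum)
    pairForm pairForm_swap

/-- Identifying two variables is restriction to the hyperplane where they agree, on which no single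
form vanishes. -/
theorem pairProduct_collapse_ne_zero {k' : Fin l → ℕ} (hsum : 1 < ∑ i, k' i) (i : Fin l)
    (a b : Fin n) :
    rename (fun y => if y = (i, b) then (i, a) else y) (pairProduct n k') ≠ 0 := by
  rw [pairProduct, map_prod, Finset.prod_ne_zero_iff]
  intro p hp h
  obtain ⟨x, hx, hne⟩ := exists_eval_pairForm_ne_zero hsum hp i a b
  refine hne ?_
  have h1 := congrArg (eval x) h
  rw [eval_rename, map_zero] at h1
  rw [← h1]
  congr 2
  funext y
  by_cases hy : y = (i, b)
  · simp [hy, hx]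
  · simp [hy]

/-- The stabilizer of `q` is a subgroup, so transpositions within one block suffice. Such a
transposition fixes `q ^ 2`, hence sends `q` to `q` or `-q`. -/
theorem rename_eq_of_sq_eq_pairProduct {k' : Fin l → ℕ} (hsum : 1 < ∑ i, k' i)
    {q : MvPolynomial (Fin l × Fin n) ℂ} (hq : q ^ 2 = pairProduct n k')
    (σ : Fin l → Equiv.Perm (Fin n)) : rename (blockPerm σ) q = q := by
  let H : Subgroup (Fin l → Equiv.Perm (Fin n)) :=
    { carrier := {σ | rename (blockPerm σ) q = q}
      mul_mem' := by
        intro σ τ hσ hτ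
        have : blockPerm (σ * τ) = blockPerm σ ∘ blockPerm τ := rfl
        rw [Set.mem_ofPred_eq] at hσ hτ ⊢
        rw [this, ← rename_rename, hτ, hσ]
      one_mem' := by
        change rename id q = q
        exact rename_id_apply q
      inv_mem' := by
        intro σ hσ
        rw [Set.mem_ofPred_eq] at hσ ⊢
        conv_lhs => rw [← hσ, rename_rename]
        have : blockPerm σ⁻¹ ∘ blockPerm σ = id := by
          funext x
          simp [blockPerm]
        rw [this, rename_id_apply] }
  suffices σ ∈ H from this
  refine Subgroup.pi_mem_of_mulSingle_mem σ fun i => ?_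
  induction σ i using Equiv.Perm.swap_induction_on with
  | one => rw [Pi.mulSingle_one]; exact H.one_mem
  | swap_mul τ a b hab ih =>
    rw [Pi.mulSingle_mul]
    refine H.mul_mem ?_ ih
    change rename _ q = q
    have hsq : (rename (blockPerm (Pi.mulSingle i (Equiv.swap a b))) q) ^ 2 = q ^ 2 := by
      rw [← map_pow, hq, rename_pairProduct]
    rcases sq_eq_sq_iff_eq_or_eq_neg.1 hsq with h | h
    · exact h
    · exfalso
      -- On the hyperplane the transposition acts trivially, so a change of sign would force `q`,
      -- and with it `pairProduct`, to vanish there.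
      have h1 := congrArg (rename fun y => if y = (i, b) then (i, a) else y) h
      rw [rename_rename] at h1
      have h2 : (fun y => if y = (i, b) then (i, a) else y) ∘
          blockPerm (Pi.mulSingle i (Equiv.swap a b))
          = fun y : Fin l × Fin n => if y = (i, b) then (i, a) else y := by
        funext ⟨i', j⟩
        by_cases hi : i' = i
        · subst hi
          by_cases hja : j = a
          · subst hja
            simp [blockPerm, hab]
          · by_cases hjb : j = b
            · subst hjb
              simp [blockPerm, hab]
            · simp [blockPerm, Equiv.swap_apply_of_ne_of_ne hja hjb]
        · simp [blockPerm, hi]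
      rw [h2, map_neg, self_eq_neg] at h1
      apply pairProduct_collapse_ne_zero (k' := k') hsum i a b
      rw [← hq, map_pow, h1]
      simp

end PairForms

/-! ### Multiplicity of the pair forms in the discriminant of the operator. -/

section Vandermonde

theorem prod_offDiag_dvd_det_vandermonde_sq {R : Type*} [CommRing R] {N : ℕ} (v : Fin N → R) :
    ∏ p ∈ (Finset.univ : Finset (Fin N)).offDiag, (v p.1 - v p.2)
      ∣ (Matrix.vandermonde v).det ^ 2 := by
  classical
  rw [← Finset.prod_filter_mul_prod_filter_not _ (fun p : Fin N × Fin N => p.1 < p.2), sq,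
    Matrix.det_vandermonde]
  refine mul_dvd_mul ?_ (Eq.dvd ?_)
  · rw [Finset.prod_finset_product _ Finset.univ (fun c => Finset.Ioi c)]
    · refine Finset.prod_dvd_prod_of_dvd _ _ fun i _ => Finset.prod_dvd_prod_of_dvd _ _ fun j _ => ?_
      rw [← neg_sub, neg_dvd]
    · intro p
      simp only [Finset.mem_filter, Finset.mem_offDiag, Finset.mem_univ, true_and, Finset.mem_Ioi]
      exact ⟨fun h => h.2, fun h => ⟨h.ne, h⟩⟩
  · rw [Finset.prod_finset_product_right _ Finset.univ (fun c => Finset.Ioi c)]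
    intro p
    simp only [Finset.mem_filter, Finset.mem_offDiag, Finset.mem_univ, true_and, Finset.mem_Ioi,
      not_lt]
    exact ⟨fun h => lt_of_le_of_ne h.2 h.1.symm, fun h => ⟨h.ne', h.le⟩⟩

variable {n l : ℕ}

/-- The families of subsets disjoint from a given pair which complete it to two families of the
sizes `k i`. -/
def completions (n : ℕ) (k k' : Fin l → ℕ)
    (p : (Fin l → Finset (Fin n)) × (Fin l → Finset (Fin n))) : Finset (Fin l → Finset (Fin n)) :=
  Fintype.piFinset fun i => Finset.powersetCard (k i - k' i) (p.1 i ∪ p.2 i)ᶜ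

theorem card_completions (k k' : Fin l → ℕ)
    {p : (Fin l → Finset (Fin n)) × (Fin l → Finset (Fin n))} (hp : p ∈ disjointPairs n k') :
    (completions n k k' p).card = ∏ i, (n - 2 * k' i).choose (k i - k' i) := by
  simp only [disjointPairs, Finset.mem_filter, Finset.mem_univ, true_and] at hp
  rw [completions, Fintype.card_piFinset]
  refine Finset.prod_congr rfl fun i _ => ?_
  obtain ⟨h1, h2, h3⟩ := hp i
  rw [Finset.card_powersetCard, Finset.card_compl, Finset.card_union_of_disjoint h3, h1, h2,
    Fintype.card_fin, two_mul]

theorem pairForm_eq_familySum_sub (p : (Fin l → Finset (Fin n)) × (Fin l → Finset (Fin n)))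
    (c : Fin l → Finset (Fin n)) (hc : ∀ i, Disjoint (p.1 i ∪ p.2 i) (c i)) :
    pairForm p = familySum (fun i j => MvPolynomial.X (i, j)) (fun i => p.1 i ∪ c i)
      - familySum (fun i j => MvPolynomial.X (i, j)) (fun i => p.2 i ∪ c i) := by
  rw [pairForm, familySum, familySum, ← Finset.sum_sub_distrib]
  refine Finset.sum_congr rfl fun i _ => ?_
  have h := hc i
  rw [Finset.disjoint_union_left] at h
  rw [Finset.sum_union h.1, Finset.sum_union h.2]
  ring

/-- A power of the product of the pair forms divides the discriminant of the eigenvalues of the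
generic diagonal operator. -/
theorem pairProduct_pow_dvd_vandermonde_sq (k k' : Fin l → ℕ) (hk' : ∀ i, k' i ≤ k i)
    (hsum : 1 < ∑ i, k' i) :
    pairProduct n k' ^ (∏ i, (n - 2 * k' i).choose (k i - k' i)) ∣
      (Matrix.vandermonde fun c : Fin (∏ i, n.choose (k i)) =>
        familySum (fun i j => (MvPolynomial.X (i, j) : MvPolynomial (Fin l × Fin n) ℂ))
          (fun i => (indexEquiv n k c i : Finset (Fin n)))).det ^ 2 := by
  classical
  refine dvd_trans ?_ (prod_offDiag_dvd_det_vandermonde_sq _)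
  set ν : Fin (∏ i, n.choose (k i)) → Fin l → Finset (Fin n) :=
    fun c i => (indexEquiv n k c i : Finset (Fin n)) with hν
  have hνinj : Function.Injective ν := by
    intro a b hab
    refine (indexEquiv n k).injective (funext fun i => Subtype.ext (congrFun hab i))
  have hνsurj : ∀ S : Fin l → Finset (Fin n), (∀ i, (S i).card = k i) → ∃ c, ν c = S := by
    intro S hS
    refine ⟨(indexEquiv n k).symm fun i => ⟨S i, hS i⟩, ?_⟩
    simp only [hν, Equiv.apply_symm_apply]
  -- Passing from indices to families of subsets lets the product over pairs and completions appear
  -- as a subproduct.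
  have himage : ∏ p ∈ (Finset.univ : Finset (Fin (∏ i, n.choose (k i)))).offDiag,
        (familySum (fun i j => (MvPolynomial.X (i, j) : MvPolynomial (Fin l × Fin n) ℂ)) (ν p.1)
          - familySum (fun i j => MvPolynomial.X (i, j)) (ν p.2))
      = ∏ p ∈ (Finset.univ.image ν).offDiag,
        (familySum (fun i j => (MvPolynomial.X (i, j) : MvPolynomial (Fin l × Fin n) ℂ)) p.1
          - familySum (fun i j => MvPolynomial.X (i, j)) p.2) := by
    refine Finset.prod_nbij (fun p => (ν p.1, ν p.2)) ?_ ?_ ?_ ?_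
    · intro p hp
      simp only [Finset.mem_offDiag, Finset.mem_univ, true_and] at hp
      simp only [Finset.mem_offDiag, Finset.mem_image_of_mem ν (Finset.mem_univ _), true_and]
      exact fun h => hp (hνinj h)
    · intro p _ q _ h
      exact Prod.ext (hνinj (congrArg Prod.fst h)) (hνinj (congrArg Prod.snd h))
    · rintro ⟨S, T⟩ hST
      simp only [Finset.coe_offDiag, Set.mem_offDiag, Finset.coe_image, Finset.coe_univ,
        Set.image_univ, Set.mem_range] at hST
      obtain ⟨⟨a, rfl⟩, ⟨b, rfl⟩, hab⟩ := hST
      exact ⟨(a, b), by simpa using fun h => hab (congrArg ν h), rfl⟩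
    · exact fun _ _ => rfl
  rw [himage]
  have hpow : pairProduct n k' ^ (∏ i, (n - 2 * k' i).choose (k i - k' i))
      = ∏ q ∈ (disjointPairs n k').sigma (completions n k k'), pairForm q.1 := by
    rw [Finset.prod_sigma, pairProduct, ← Finset.prod_pow]
    refine Finset.prod_congr rfl fun p hp => ?_
    rw [← card_completions k k' hp]
    exact (Finset.prod_const _).symm
  have hmem : ∀ q ∈ (disjointPairs n k').sigma (completions n k k'), ∀ i,
      (q.1.1 i).card = k' i ∧ (q.1.2 i).card = k' i ∧ Disjoint (q.1.1 i) (q.1.2 i) ∧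
      (q.2 i).card = k i - k' i ∧ Disjoint (q.1.1 i) (q.2 i) ∧ Disjoint (q.1.2 i) (q.2 i) := by
    intro q hq i
    simp only [Finset.mem_sigma, disjointPairs, Finset.mem_filter, Finset.mem_univ, true_and,
      completions, Fintype.mem_piFinset, Finset.mem_powersetCard] at hq
    obtain ⟨h1, h2, h3⟩ := hq.1 i
    obtain ⟨h4, h5⟩ := hq.2 i
    have h6 := (Finset.subset_compl_iff_disjoint_left).1 h4
    rw [Finset.disjoint_union_left] at h6
    exact ⟨h1, h2, h3, h5, h6.1, h6.2⟩
  have hsdiff : ∀ {F G C : Finset (Fin n)}, Disjoint F G → Disjoint F C →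
      (F ∪ C) \ (G ∪ C) = F := by
    intro F G C h1 h2
    ext a
    simp only [Finset.mem_sdiff, Finset.mem_union]
    have h3 : a ∈ F → a ∉ G := fun h => Finset.disjoint_left.1 h1 h
    have h4 : a ∈ F → a ∉ C := fun h => Finset.disjoint_left.1 h2 h
    tauto
  rw [hpow]
  -- `F` and `G` are recovered as the two set differences of `F ∪ C` and `G ∪ C`, and then `C` as
  -- the complement of `F` in `F ∪ C`.
  have hinj : Set.InjOn (fun q : (_ : (Fin l → Finset (Fin n)) × (Fin l → Finset (Fin n))) ×
      (Fin l → Finset (Fin n)) => ((fun i => q.1.1 i ∪ q.2 i), (fun i => q.1.2 i ∪ q.2 i)))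
      ((disjointPairs n k').sigma (completions n k k')) := by
    intro q hq r hr h
    have hq := hmem q hq
    have hr := hmem r hr
    have h1 : ∀ i, q.1.1 i ∪ q.2 i = r.1.1 i ∪ r.2 i := congrFun (congrArg Prod.fst h)
    have h2 : ∀ i, q.1.2 i ∪ q.2 i = r.1.2 i ∪ r.2 i := congrFun (congrArg Prod.snd h)
    have e1 : q.1.1 = r.1.1 := by
      funext i
      rw [← hsdiff (hq i).2.2.1 (hq i).2.2.2.2.1, ← hsdiff (hr i).2.2.1 (hr i).2.2.2.2.1, h1, h2]
    have e2 : q.1.2 = r.1.2 := by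
      funext i
      rw [← hsdiff (hq i).2.2.1.symm (hq i).2.2.2.2.2, ← hsdiff (hr i).2.2.1.symm
        (hr i).2.2.2.2.2, h1, h2]
    have e3 : q.2 = r.2 := by
      funext i
      rw [← Finset.union_sdiff_cancel_left (hq i).2.2.2.2.1,
        ← Finset.union_sdiff_cancel_left (hr i).2.2.2.2.1, h1, e1]
    exact Sigma.ext (Prod.ext e1 e2) (heq_of_eq e3)
  have hprod := Finset.prod_image (f := fun p : (Fin l → Finset (Fin n)) × (Fin l → Finset (Fin n))
    => (familySum (fun i j => (MvPolynomial.X (i, j) : MvPolynomial (Fin l × Fin n) ℂ)) p.1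
          - familySum (fun i j => MvPolynomial.X (i, j)) p.2)) hinj
  have hform : ∏ q ∈ (disjointPairs n k').sigma (completions n k k'), pairForm q.1
      = ∏ q ∈ (disjointPairs n k').sigma (completions n k k'),
        (familySum (fun i j => (MvPolynomial.X (i, j) : MvPolynomial (Fin l × Fin n) ℂ))
            (fun i => q.1.1 i ∪ q.2 i)
          - familySum (fun i j => MvPolynomial.X (i, j)) (fun i => q.1.2 i ∪ q.2 i)) := by
    refine Finset.prod_congr rfl fun q hq => pairForm_eq_familySum_sub q.1 q.2 fun i => ?_
    rw [Finset.disjoint_union_left]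
    exact (hmem q hq i).2.2.2.2
  rw [hform, ← hprod]
  refine Finset.prod_dvd_prod_of_subset _ _ _ fun p hp => ?_
  obtain ⟨q, hq, rfl⟩ := Finset.mem_image.1 hp
  have hq := hmem q hq
  simp only [Finset.mem_offDiag, Finset.mem_image, Finset.mem_univ, true_and]
  refine ⟨hνsurj _ fun i => ?_, hνsurj _ fun i => ?_, fun h => ?_⟩
  · rw [Finset.card_union_of_disjoint (hq i).2.2.2.2.1, (hq i).1, (hq i).2.2.2.1,
      Nat.add_sub_cancel' (hk' i)]
  · rw [Finset.card_union_of_disjoint (hq i).2.2.2.2.2, (hq i).2.1, (hq i).2.2.2.1,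
      Nat.add_sub_cancel' (hk' i)]
  · have : ∑ i, k' i = 0 := by
      refine Finset.sum_eq_zero fun i _ => ?_
      have h1 := hsdiff (hq i).2.2.1 (hq i).2.2.2.2.1
      rw [congrFun h i, Finset.sdiff_self] at h1
      rw [← (hq i).1, ← h1, Finset.card_empty]
    omega

end Vandermonde

/-! ### Descent from diagonalized tuples to polynomials in the entries. -/

section Diagonalization

open MvPolynomial

variable {n l : ℕ}

theorem exists_diagonalization (A : Matrix (Fin n) (Fin n) ℂ) (lam : Fin n → ℂ)
    (h : A.charpoly = ∏ j, (Polynomial.X - Polynomial.C (lam j))) (hinj : Function.Injective lam) :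
    ∃ U V : Matrix (Fin n) (Fin n) ℂ, U * V = 1 ∧ U * Matrix.diagonal lam * V = A := by
  have hroot : ∀ j, ∃ v, Module.End.HasEigenvector (Matrix.toLin' A) (lam j) v := by
    intro j
    refine Module.End.HasEigenvalue.exists_hasEigenvector ?_
    rw [Module.End.hasEigenvalue_iff_isRoot_charpoly, Matrix.charpoly_toLin', h,
      Polynomial.IsRoot.def, Polynomial.eval_prod]
    exact Finset.prod_eq_zero (Finset.mem_univ j) (by simp)
  choose v hv using hroot
  have hli := Module.End.eigenvectors_linearIndependent' (Matrix.toLin' A) lam hinj v hv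
  set U : Matrix (Fin n) (Fin n) ℂ := Matrix.of fun a j => v j a with hU
  have hcols : LinearIndependent ℂ U.col := hli
  rw [Matrix.linearIndependent_cols_iff_isUnit, Matrix.isUnit_iff_isUnit_det] at hcols
  have hAU : A * U = U * Matrix.diagonal lam := by
    ext a j
    rw [Matrix.mul_diagonal]
    have h1 := congrFun (hv j).apply_eq_smul a
    rw [Matrix.toLin'_apply, Pi.smul_apply, smul_eq_mul] at h1
    rw [hU, Matrix.of_apply, mul_comm, ← h1]
    rfl
  refine ⟨U, U⁻¹, Matrix.mul_nonsing_inv U hcols, ?_⟩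
  rw [← hAU, mul_assoc, Matrix.mul_nonsing_inv U hcols, mul_one]

/-- The substitution `A i ↦ U i * diagonal (X (i, ·)) * V i`. -/
def conjHom (U V : Fin l → Matrix (Fin n) (Fin n) ℂ) :
    EntryPoly n l →ₐ[ℂ] MvPolynomial (Fin l × Fin n) ℂ :=
  aeval fun y => ((U y.1).map C * Matrix.diagonal (fun j => X (y.1, j)) * (V y.1).map C :
    Matrix (Fin n) (Fin n) (MvPolynomial (Fin l × Fin n) ℂ)) y.2.1 y.2.2

theorem eval_conjHom (U V : Fin l → Matrix (Fin n) (Fin n) ℂ) (x : Fin l → Fin n → ℂ)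
    (f : EntryPoly n l) :
    eval (fun y => x y.1 y.2) (conjHom U V f)
      = eval (fun y : Fin l × Fin n × Fin n =>
          (U y.1 * Matrix.diagonal (x y.1) * V y.1) y.2.1 y.2.2) f := by
  induction f using MvPolynomial.induction_on with
  | C a => simp [conjHom, MvPolynomial.algebraMap_eq]
  | add p q hp hq => rw [map_add, map_add, hp, hq, map_add]
  | mul_X p y hp =>
    rw [map_mul, map_mul, hp, map_mul]
    congr 1
    rw [conjHom, aeval_X, eval_X]
    simp [Matrix.mul_apply, Matrix.diagonal_apply]

/-- Conjugation preserves the characteristic polynomial, and a polynomial over `ℂ` is determined by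
its values. -/
theorem conjHom_eq {U V : Fin l → Matrix (Fin n) (Fin n) ℂ} (hUV : ∀ i, U i * V i = 1)
    {Q : EntryPoly n l} {p : MvPolynomial (Fin l × Fin n) ℂ}
    (hQ : ∀ (A : Fin l → Matrix (Fin n) (Fin n) ℂ) (lam : Fin l → Fin n → ℂ),
      (∀ i, (A i).charpoly = ∏ j, (Polynomial.X - Polynomial.C (lam i j))) →
      eval (fun x : Fin l × Fin n × Fin n => A x.1 x.2.1 x.2.2) Q
        = eval (fun x => lam x.1 x.2) p) :
    conjHom U V Q = p := by
  refine MvPolynomial.funext fun x => ?_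
  have h1 := eval_conjHom U V (fun i j => x (i, j)) Q
  refine h1.trans (hQ (fun i => U i * Matrix.diagonal (fun j => x (i, j)) * V i)
    (fun i j => x (i, j)) fun i => ?_)
  rw [Matrix.charpoly_mul_comm, ← mul_assoc, mul_eq_one_comm.1 (hUV i), one_mul,
    Matrix.charpoly_diagonal]

theorem vandermonde_dvd_conjHom_krylovDet (k : Fin l → ℕ) (hk : ∑ i, k i = n)
    {U V : Fin l → Matrix (Fin n) (Fin n) ℂ} (hUV : ∀ i, U i * V i = 1) :
    (Matrix.vandermonde fun c : Fin (∏ i, n.choose (k i)) =>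
        familySum (fun i j => (X (i, j) : MvPolynomial (Fin l × Fin n) ℂ))
          (fun i => (indexEquiv n k c i : Finset (Fin n)))).det
      ∣ conjHom U V (krylovDet n k) := by
  have hmap : ∀ {W W' : Matrix (Fin n) (Fin n) ℂ}, W * W' = 1 →
      W.map (C : ℂ →+* MvPolynomial (Fin l × Fin n) ℂ) * W'.map C = 1 := by
    intro W W' h
    rw [← Matrix.map_mul, h, Matrix.map_one _ (map_zero _) (map_one _)]
  have h1 := krylovMatrix_map (conjHom U V).toRingHom k hk (genericMatrix n l)
  have h2 : conjHom U V (krylovDet n k)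
      = (krylovMatrix k fun i => (genericMatrix n l i).map (conjHom U V).toRingHom).det := by
    rw [h1]
    exact RingHom.map_det (conjHom U V).toRingHom _
  rw [h2]
  refine vandermonde_dvd_det_krylovMatrix k _ (fun i => (U i).map C) (fun i => (V i).map C) _
    (fun i => hmap (hUV i)) fun i => ?_
  have h3 : (genericMatrix n l i).map (conjHom U V).toRingHom
      = (U i).map C * Matrix.diagonal (fun j => X (i, j)) * (V i).map C := by
    ext1 a b
    rw [Matrix.map_apply, genericMatrix, Matrix.of_apply]
    exact aeval_X _ _
  rw [h3, mul_assoc, hmap (mul_eq_one_comm.1 (hUV i)), mul_one]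

/-- The product over the blocks of the discriminants of the variables in the block. -/
def blockDiscriminant (n l : ℕ) : MvPolynomial (Fin l × Fin n) ℂ :=
  ∏ i, ∏ p ∈ (Finset.univ : Finset (Fin n)).offDiag, (X (i, p.1) - X (i, p.2))

theorem rename_blockDiscriminant (σ : Fin l → Equiv.Perm (Fin n)) :
    rename (blockPerm σ) (blockDiscriminant n l) = blockDiscriminant n l := by
  rw [blockDiscriminant, map_prod]
  refine Finset.prod_congr rfl fun i _ => ?_
  rw [map_prod]
  refine Finset.prod_nbij' (fun p => (σ i p.1, σ i p.2))
    (fun p => ((σ i).symm p.1, (σ i).symm p.2)) ?_ ?_ ?_ ?_ ?_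
  · intro p hp
    simpa using hp
  · intro p hp
    simpa using hp
  · intro p _
    simp
  · intro p _
    simp
  · intro p _
    simp [blockPerm]

theorem irreducible_X_sub_X {σ : Type*} {a b : σ} (h : a ≠ b) :
    Irreducible (X a - X b : MvPolynomial σ ℂ) := by
  classical
  have hcoeff : coeff (Finsupp.single a 1) (X a - X b : MvPolynomial σ ℂ) = 1 := by
    rw [coeff_sub, coeff_X, coeff_X, if_pos rfl, if_neg, sub_zero]
    intro hab
    exact h.symm ((Finsupp.single_left_inj one_ne_zero).1 hab)
  refine irreducible_of_totalDegree_eq_one ?_ ?_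
  · apply le_antisymm
    · refine (totalDegree_sub _ _).trans ?_
      simp
    · have hmem : Finsupp.single a 1 ∈ (X a - X b : MvPolynomial σ ℂ).support := by
        rw [mem_support_iff, hcoeff]
        exact one_ne_zero
      simpa using le_totalDegree hmem
  · intro x hx
    exact isUnit_of_dvd_one (hcoeff ▸ hx (Finsupp.single a 1))

theorem blockDiscriminant_ne_zero : blockDiscriminant n l ≠ 0 := by
  rw [blockDiscriminant, Finset.prod_ne_zero_iff]
  intro i _
  rw [Finset.prod_ne_zero_iff]
  intro p hp
  rw [Finset.mem_offDiag] at hp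
  exact (irreducible_X_sub_X (a := (i, p.1)) (b := (i, p.2)) (by simpa using hp.2.2)).ne_zero

theorem pairProduct_ne_zero {k' : Fin l → ℕ} (hsum : 1 < ∑ i, k' i) : pairProduct n k' ≠ 0 := by
  rw [pairProduct, Finset.prod_ne_zero_iff]
  intro p hp h
  obtain ⟨i, -, hi⟩ := Finset.exists_ne_zero_of_sum_ne_zero (s := Finset.univ) (f := k') (by omega)
  have hcard : (p.1 i).card = k' i := by
    simp only [disjointPairs, Finset.mem_filter, Finset.mem_univ, true_and] at hp
    exact (hp i).1
  obtain ⟨a, -⟩ := Finset.card_ne_zero.1 (hcard ▸ hi)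
  obtain ⟨x, -, hx⟩ := exists_eval_pairForm_ne_zero hsum hp i a a
  exact hx (by rw [h, map_zero])

/-- `Δ` is the polynomial in the entries of the matrices whose value is the product of the
discriminants of the characteristic polynomials. -/
def IsBlockDiscriminant (Δ : EntryPoly n l) : Prop :=
  ∀ (A : Fin l → Matrix (Fin n) (Fin n) ℂ) (lam : Fin l → Fin n → ℂ),
    (∀ i, (A i).charpoly = ∏ j, (Polynomial.X - Polynomial.C (lam i j))) →
    eval (fun x : Fin l × Fin n × Fin n => A x.1 x.2.1 x.2.2) Δ
      = eval (fun x => lam x.1 x.2) (blockDiscriminant n l)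

theorem IsBlockDiscriminant.ne_zero {Δ : EntryPoly n l} (hΔ : IsBlockDiscriminant Δ) : Δ ≠ 0 := by
  intro h
  refine blockDiscriminant_ne_zero (n := n) (l := l) ?_
  rw [← conjHom_eq (U := fun _ => 1) (V := fun _ => 1) (fun _ => one_mul 1) hΔ, h, map_zero]

/-- A nonzero discriminant means that each matrix has distinct eigenvalues. Evaluation at such a
point therefore factors through some `conjHom U V`. -/
theorem IsBlockDiscriminant.exists_diagonalization {Δ : EntryPoly n l}
    (hΔ : IsBlockDiscriminant Δ) {A : Fin l × Fin n × Fin n → ℂ} (hA : eval A Δ ≠ 0) :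
    ∃ (U V : Fin l → Matrix (Fin n) (Fin n) ℂ) (x : Fin l → Fin n → ℂ), (∀ i, U i * V i = 1) ∧
      ∀ f : EntryPoly n l, eval A f = eval (fun y => x y.1 y.2) (conjHom U V f) := by
  choose lam hlam using fun i : Fin l =>
    exists_eigenvalues (Matrix.of fun a b => A (i, a, b) : Matrix (Fin n) (Fin n) ℂ)
  have h1 := hΔ (fun i => Matrix.of fun a b => A (i, a, b)) lam hlam
  have h2 : eval (fun x => lam x.1 x.2) (blockDiscriminant n l) ≠ 0 := by
    rw [← h1]
    exact hA
  have hinj : ∀ i, Function.Injective (lam i) := by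
    intro i a b hab
    by_contra hne
    refine h2 ?_
    rw [blockDiscriminant, map_prod]
    refine Finset.prod_eq_zero (Finset.mem_univ i) ?_
    rw [map_prod]
    refine Finset.prod_eq_zero (i := (a, b)) (by simpa using hne) ?_
    simp [hab]
  choose U V hUV hA' using fun i =>
    KrylovTuple.exists_diagonalization _ (lam i) (hlam i) (hinj i)
  refine ⟨U, V, lam, hUV, fun f => ?_⟩
  rw [eval_conjHom]
  simp only [hA']
  rfl

/-- The eigenvalue product and the discriminant have no common irreducible factor. -/
theorem IsBlockDiscriminant.not_dvd {k' : Fin l → ℕ} (hsum : 1 < ∑ i, k' i) {d Δ h : EntryPoly n l}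
    (hΔ : IsBlockDiscriminant Δ)
    (hd : ∀ U V : Fin l → Matrix (Fin n) (Fin n) ℂ, (∀ i, U i * V i = 1) →
      conjHom U V d = pairProduct n k')
    (hh : Irreducible h) (hhd : h ∣ d) : ¬ h ∣ Δ := by
  intro hhΔ
  by_cases H : ∀ U V : Fin l → Matrix (Fin n) (Fin n) ℂ, (∀ i, U i * V i = 1) →
      IsUnit (conjHom U V h)
  -- If every substitution makes `h` a constant, setting the eigenvalues to zero identifies this
  -- constant as the value of `h` at the zero matrices. Then `h` is constant wherever `Δ` is
  -- nonzero, hence everywhere.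
  · have hzero : (h - C (eval 0 h)) * Δ = 0 := by
      refine MvPolynomial.funext fun A => ?_
      rw [map_mul, map_zero]
      by_cases hA : eval A Δ = 0
      · rw [hA, mul_zero]
      · obtain ⟨U, V, x, hUV, hf⟩ := hΔ.exists_diagonalization hA
        obtain ⟨r, -, hr⟩ := isUnit_iff_eq_C_of_isReduced.1 (H U V hUV)
        have h0 := eval_conjHom U V (fun _ _ => 0) h
        rw [hr, eval_C] at h0
        have h1 : (fun y : Fin l × Fin n × Fin n =>
            (U y.1 * Matrix.diagonal (fun _ => 0) * V y.1 : Matrix (Fin n) (Fin n) ℂ)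
              y.2.1 y.2.2) = 0 := by
          funext y
          simp
        rw [h1] at h0
        rw [map_sub, eval_C, hf h, hr, eval_C, h0, sub_self, zero_mul]
    have hC : h = C (eval 0 h) :=
      sub_eq_zero.1 ((mul_eq_zero.1 hzero).resolve_right hΔ.ne_zero)
    refine hh.not_isUnit ?_
    rw [hC]
    refine (isUnit_iff_ne_zero.2 fun h0 => hh.ne_zero ?_).map C
    rw [hC, h0, map_zero]
  · push Not at H
    obtain ⟨U, V, hUV, hnu⟩ := H
    have hdvd : conjHom U V h ∣ pairProduct n k' := hd U V hUV ▸ map_dvd (conjHom U V) hhd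
    obtain ⟨q, hq, hqh⟩ := WfDvdMonoid.exists_irreducible_factor hnu
      (ne_zero_of_dvd_ne_zero (pairProduct_ne_zero hsum) hdvd)
    obtain ⟨p, hp, hqp⟩ := hq.prime.exists_mem_finset_dvd (hqh.trans hdvd)
    have hΔ' : conjHom U V h ∣ blockDiscriminant n l :=
      conjHom_eq hUV hΔ ▸ map_dvd (conjHom U V) hhΔ
    obtain ⟨i, -, hqi⟩ := hq.prime.exists_mem_finset_dvd (hqh.trans hΔ')
    obtain ⟨c, hc, hqc⟩ := hq.prime.exists_mem_finset_dvd hqi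
    rw [Finset.mem_offDiag] at hc
    have hirr : Irreducible (X (i, c.1) - X (i, c.2) : MvPolynomial (Fin l × Fin n) ℂ) :=
      irreducible_X_sub_X (by simpa using hc.2.2)
    -- The common factor is a difference of two variables up to a unit, so the pair form would
    -- vanish on that hyperplane.
    obtain ⟨r, hr⟩ := ((hq.associated_of_dvd hirr hqc).symm.dvd).trans hqp
    obtain ⟨x, hx, hne⟩ := exists_eval_pairForm_ne_zero hsum hp i c.1 c.2
    refine hne ?_
    rw [hr]
    simp [hx]

/-- Divisibility of polynomials in the entries can be checked on diagonalizable families, if the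
divisor has no irreducible factor in common with the discriminant. -/
theorem IsBlockDiscriminant.dvd_of_conjHom_dvd {Δ f g : EntryPoly n l}
    (hΔ : IsBlockDiscriminant Δ) (hg : ∀ h, Irreducible h → h ∣ g → ¬ h ∣ Δ)
    (hne : ∀ U V : Fin l → Matrix (Fin n) (Fin n) ℂ, (∀ i, U i * V i = 1) → conjHom U V g ≠ 0)
    (hdvd : ∀ U V : Fin l → Matrix (Fin n) (Fin n) ℂ, (∀ i, U i * V i = 1) →
      conjHom U V g ∣ conjHom U V f) : g ∣ f := by
  have hg0 : g ≠ 0 := by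
    rintro rfl
    exact hne (fun _ => 1) (fun _ => 1) (fun _ => one_mul 1) (map_zero _)
  obtain ⟨g', f', c, hrel, rfl, rfl⟩ := UniqueFactorizationMonoid.exists_reduced_factors g hg0 f
  by_cases hu : IsUnit g'
  · exact mul_dvd_mul_left c hu.dvd
  exfalso
  obtain ⟨h, hh, hhg⟩ := WfDvdMonoid.exists_irreducible_factor hu (right_ne_zero_of_mul hg0)
  -- At a zero of `h` either `Δ` vanishes or the tuple is diagonalizable; in the second case `g'`
  -- divides `f'` after substitution, so `f'` vanishes as well. By the Nullstellensatz `h` divides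
  -- `f' * Δ`, although it divides neither factor.
  have hmem : f' * Δ ∈ vanishingIdeal ℂ (zeroLocus ℂ (Ideal.span {h})) := by
    rw [mem_vanishingIdeal_iff]
    intro A hA
    have hA0 : eval A h = 0 := by
      simpa [coe_aeval_eq_eval] using hA h (Ideal.mem_span_singleton_self h)
    suffices eval A (f' * Δ) = 0 by simpa [coe_aeval_eq_eval] using this
    rw [map_mul]
    by_cases hAΔ : eval A Δ = 0
    · rw [hAΔ, mul_zero]
    · obtain ⟨U, V, x, hUV, hev⟩ := hΔ.exists_diagonalization hAΔ
      have h1 := hdvd U V hUV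
      have h2 := hne U V hUV
      rw [map_mul] at h1 h2
      rw [map_mul, mul_dvd_mul_iff_left (left_ne_zero_of_mul h2)] at h1
      obtain ⟨r, hr⟩ := h1
      obtain ⟨s, hs⟩ := hhg
      rw [hev f', hr, map_mul, ← hev g', hs, map_mul, hA0, zero_mul, zero_mul, zero_mul]
  have hprime : (Ideal.span {h}).IsPrime := (Ideal.span_singleton_prime hh.ne_zero).2 hh.prime
  rw [IsPrime.vanishingIdeal_zeroLocus, Ideal.mem_span_singleton] at hmem
  rcases hh.prime.dvd_or_dvd hmem with h1 | h1
  · exact hh.not_isUnit (hrel hhg h1)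
  · exact hg h hh (hhg.mul_left c) h1

end Diagonalization

end KrylovTuple

end

/-! ### The main theorem. -/

theorem mainTheorem7 (n l : ℕ) (k : Fin l → ℕ) (hk : ∑ i, k i = n)
    (k' : Fin l → ℕ) (hk' : ∀ i, k' i ≤ k i) (hsum : 1 < ∑ i, k' i) :
    ∃ d : KrylovTuple.EntryPoly n l, KrylovTuple.IsEigenvalueProduct n k' d ∧
      (∃ D : KrylovTuple.EntryPoly n l, D ^ 2 = d) ∧
      ∀ D : KrylovTuple.EntryPoly n l, D ^ 2 = d →
        D ^ (∏ i, (n - 2 * k' i).choose (k i - k' i)) ∣ KrylovTuple.krylovDet n k := by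
  open KrylovTuple in
  obtain ⟨d, hd⟩ := exists_eval_eq_of_blockSymmetric (rename_pairProduct (n := n) k')
  obtain ⟨q, hq⟩ := exists_sq_eq_pairProduct (n := n) hsum
  obtain ⟨D₀, hD₀⟩ := exists_eval_eq_of_blockSymmetric (rename_eq_of_sq_eq_pairProduct hsum hq)
  obtain ⟨Δ, hΔ⟩ := exists_eval_eq_of_blockSymmetric (rename_blockDiscriminant (n := n) (l := l))
  have hΔ : IsBlockDiscriminant Δ := hΔ
  refine ⟨d, ?_, ⟨D₀, ?_⟩, ?_⟩
  · intro A lam h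
    rw [hd A lam h, pairProduct, map_prod]
    exact Finset.prod_congr rfl fun p _ => eval_pairForm _ p
  · refine MvPolynomial.funext fun A => ?_
    choose lam hlam using fun i : Fin l =>
      exists_eigenvalues (Matrix.of fun a b => A (i, a, b) : Matrix (Fin n) (Fin n) ℂ)
    have h1 := hD₀ (fun i => Matrix.of fun a b => A (i, a, b)) lam hlam
    have h2 := hd (fun i => Matrix.of fun a b => A (i, a, b)) lam hlam
    rw [map_pow]
    refine (congrArg (· ^ 2) h1).trans (Eq.trans ?_ h2.symm)
    rw [← hq, map_pow]
  · intro D hD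
    have hconj : ∀ U V : Fin l → Matrix (Fin n) (Fin n) ℂ, (∀ i, U i * V i = 1) →
        conjHom U V d = pairProduct n k' := fun U V hUV => conjHom_eq hUV hd
    refine hΔ.dvd_of_conjHom_dvd ?_ ?_ ?_
    · intro h hh hhD
      refine hΔ.not_dvd hsum hconj hh ?_
      rw [← hD]
      exact dvd_pow (hh.prime.dvd_of_dvd_pow hhD) two_ne_zero
    · intro U V hUV h0
      rw [map_pow] at h0
      refine pairProduct_ne_zero (n := n) hsum ?_
      rw [← hconj U V hUV, ← hD, map_pow, eq_zero_of_pow_eq_zero h0, zero_pow two_ne_zero]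
    · intro U V hUV
      refine dvd_trans ?_ (vandermonde_dvd_conjHom_krylovDet k hk hUV)
      -- `D` is known only through `D ^ 2 = d`. Divisibility may be tested on squares because the
      -- polynomial ring is integrally closed.
      rw [← IsIntegrallyClosed.pow_dvd_pow_iff two_ne_zero, map_pow, ← pow_mul, mul_comm, pow_mul,
        ← map_pow, hD, hconj U V hUV]
      exact pairProduct_pow_dvd_vandermonde_sq k k' hk' hsum
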